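/- Let $\Omega=(0,1)^3$. For $K\in\mathbb{N}=\{0,1,2,\dots\}$ put $N=2K+1$ and $h=1/N$, and let $\mathcal{G}_N$ be the space of functions $f:\mathbb{Z}^3\to\mathbb{R}$, $(i,j,k)\mapsto f_{i,j,k}$, that are $N$-periodic in each index; $f_{i,j,k}$ is the value at the grid point $(x_i,y_j,z_k)=(ih,jh,kh)$. The discrete Fourier coefficients of $f\in\mathcal{G}_N$ are $$\hat f_{\ell,m,n}=h^3\sum_{i,j,k=0}^{N-1}f_{i,j,k}\,e^{-2\pi \mathrm{i}(\ell x_i+m y_j+n z_k)},\qquad -K\le \ell,m,n\le K .$$ The collocation Fourier spectral derivatives of $f$ are the real grid functions $$\mathcal{D}_x f_{i,j,k}=\sum_{\ell,m,n=-K}^{K}(2\pi \mathrm{i}\,\ell)\,\hat f_{\ell,m,n}\,e^{2\pi \mathrm{i}(\ell x_i+m y_j+n z_k)},\qquad \mathcal{D}_x^2 f_{i,j,k}=\sum_{\ell,m,n=-K}^{K}(-4\pi^2\ell^2)\,\hat f_{\ell,m,n}\,e^{2\pi \mathrm{i}(\ell x_i+m y_j+n z_k)},$$ and $\mathcal{D}_y,\mathcal{D}_y^2$,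 $\mathcal{D}_z,\mathcal{D}_z^2$ are defined in the same way with $m$, respectively $n$, in place of the factor $\ell$. Set $\nabla_N f=(\mathcal{D}_xf,\mathcal{D}_yf,\mathcal{D}_zf)$ and $\Delta_N f=(\mathcal{D}_x^2+\mathcal{D}_y^2+\mathcal{D}_z^2)f$. For $1\le p<\infty$ and a scalar or vector-valued grid function $g$ let $$\|g\|_p=\Bigl(h^3\sum_{i,j,k=0}^{N-1}|g_{i,j,k}|^p\Bigr)^{1/p},$$ where $|\cdot|$ is the absolute value, respectively the Euclidean norm. Then there is a constant $C>0$, depending only on $\Omega$ (so independent of $N$ and of $f$), such that for every $K\in\mathbb{N}$ and every $f\in\mathcal{G}_N$ with $N=2K+1$, $$\|\nabla_N f\|_6\le C\,\|\Delta_N f\|_2 .$$ -/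

import Mathlib

/-- Number of grid points per direction, `N = 2K + 1` (odd). -/
def gridN (K : ℕ) : ℕ := 2 * K + 1

/-- Mesh size `h` on the unit cube, `N * h = 1`. -/
noncomputable def meshSize (K : ℕ) : ℝ := 1 / (gridN K : ℝ)

/-- Indices `0, …, N - 1` of one period of the three-dimensional grid. -/
noncomputable def gridBox (K : ℕ) : Finset (Fin 3 → ℤ) :=
  Fintype.piFinset fun _ => Finset.Ico (0 : ℤ) (gridN K : ℤ)

/-- Frequencies `(ℓ, m, n)` with `-K ≤ ℓ, m, n ≤ K`. -/
noncomputable def freqBox (K : ℕ) : Finset (Fin 3 → ℤ) :=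
  Fintype.piFinset fun _ => Finset.Icc (-(K : ℤ)) (K : ℤ)

/-- The space of real grid functions on `ℤ³` that have period `N` in each direction. -/
def gridFunctions (K : ℕ) : Submodule ℝ ((Fin 3 → ℤ) → ℝ) where
  carrier := {f | ∀ (j : Fin 3 → ℤ) (a : Fin 3), f (j + Pi.single a (gridN K : ℤ)) = f j}
  zero_mem' := fun _ _ => rfl
  add_mem' := fun {f g} hf hg j a => by
    simp only [Pi.add_apply]
    rw [hf j a, hg j a]
  smul_mem' := fun c f hf j a => by
    simp only [Pi.smul_apply]
    rw [hf j a]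

/-- The phase `ℓ x_i + m y_j + n z_k` of the frequency `k` at the grid point with index `j`,
whose coordinates are `h` times the index. -/
noncomputable def gridPhase (K : ℕ) (k j : Fin 3 → ℤ) : ℝ :=
  ∑ a, (k a : ℝ) * ((j a : ℝ) * meshSize K)

/-- The discrete Fourier coefficient of `f` at the frequency `k`. -/
noncomputable def dftCoeff (K : ℕ) (f : (Fin 3 → ℤ) → ℝ) (k : Fin 3 → ℤ) : ℂ :=
  ((meshSize K : ℂ) ^ 3) * ∑ j ∈ gridBox K,
    (f j : ℂ) * Complex.exp (-(2 * (Real.pi : ℂ) * Complex.I * (gridPhase K k j : ℂ)))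

/-- The sum of `symbol k * f̂_k * exp (2πi k · x)` over the frequency box, at the grid point with
index `j`. -/
noncomputable def fourierMultiplier (K : ℕ) (symbol : (Fin 3 → ℤ) → ℂ) (f : (Fin 3 → ℤ) → ℝ)
    (j : Fin 3 → ℤ) : ℂ :=
  ∑ k ∈ freqBox K, symbol k * dftCoeff K f k *
    Complex.exp (2 * (Real.pi : ℂ) * Complex.I * (gridPhase K k j : ℂ))

/-- The collocation first derivative in the direction `a`, with symbol `2πi k_a`. The sum is real
(see `ofReal_specD`), so that taking the real part only changes the type. -/
noncomputable def specD (K : ℕ) (a : Fin 3) (f : (Fin 3 → ℤ) → ℝ) (j : Fin 3 → ℤ) : ℝ :=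
  (fourierMultiplier K (fun k => 2 * (Real.pi : ℂ) * Complex.I * (k a : ℂ)) f j).re

/-- The collocation second derivative in the direction `a`, with symbol `-4π² k_a²`. The sum is
real (see `ofReal_specD2`). -/
noncomputable def specD2 (K : ℕ) (a : Fin 3) (f : (Fin 3 → ℤ) → ℝ) (j : Fin 3 → ℤ) : ℝ :=
  (fourierMultiplier K (fun k => -4 * (Real.pi : ℂ) ^ 2 * (k a : ℂ) ^ 2) f j).re

/-- The discrete gradient, a grid function with values in Euclidean space. -/
noncomputable def specGrad (K : ℕ) (f : (Fin 3 → ℤ) → ℝ) (j : Fin 3 → ℤ) :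
    EuclideanSpace ℝ (Fin 3) :=
  WithLp.toLp 2 fun a => specD K a f j

/-- The discrete Laplacian. -/
noncomputable def specLaplacian (K : ℕ) (f : (Fin 3 → ℤ) → ℝ) (j : Fin 3 → ℤ) : ℝ :=
  ∑ a, specD2 K a f j

/-- The discrete `ℓ^p` norm `(h³ ∑ |g|^p)^(1/p)` over one period, for `1 ≤ p < ∞`, with `|·|` the
absolute value of a real grid function or the Euclidean norm of a vector-valued one. -/
noncomputable def gridNorm {E : Type*} [NormedAddCommGroup E] (K : ℕ) (p : ℝ)
    (g : (Fin 3 → ℤ) → E) : ℝ :=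
  (meshSize K ^ 3 * ∑ j ∈ gridBox K, ‖g j‖ ^ p) ^ (1 / p)

theorem gridPhase_neg (K : ℕ) (k j : Fin 3 → ℤ) : gridPhase K (-k) j = -gridPhase K k j := by
  simp [gridPhase, Finset.sum_neg_distrib]

theorem conj_dftCoeff (K : ℕ) (f : (Fin 3 → ℤ) → ℝ) (k : Fin 3 → ℤ) :
    (starRingEnd ℂ) (dftCoeff K f k) = dftCoeff K f (-k) := by
  simp [Complex.conj_ofNat, dftCoeff, gridPhase_neg, ← Complex.exp_conj]

/-- A multiplier with a Hermitian symbol maps real grid functions to real grid functions. -/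
theorem conj_fourierMultiplier (K : ℕ) (symbol : (Fin 3 → ℤ) → ℂ)
    (hs : ∀ k, (starRingEnd ℂ) (symbol k) = symbol (-k)) (f : (Fin 3 → ℤ) → ℝ) (j : Fin 3 → ℤ) :
    (starRingEnd ℂ) (fourierMultiplier K symbol f j) = fourierMultiplier K symbol f j := by
  unfold fourierMultiplier
  rw [map_sum]
  refine Finset.sum_nbij' (fun k => -k) (fun k => -k) ?_ ?_ ?_ ?_ ?_
  · intro k hk
    simp only [freqBox, Fintype.mem_piFinset, Finset.mem_Icc, Pi.neg_apply] at hk ⊢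
    exact fun a => ⟨by linarith [(hk a).2], by linarith [(hk a).1]⟩
  · intro k hk
    simp only [freqBox, Fintype.mem_piFinset, Finset.mem_Icc, Pi.neg_apply] at hk ⊢
    exact fun a => ⟨by linarith [(hk a).2], by linarith [(hk a).1]⟩
  · intro k _
    exact neg_neg k
  · intro k _
    exact neg_neg k
  · intro k _
    simp [Complex.conj_ofNat, hs, conj_dftCoeff, gridPhase_neg, ← Complex.exp_conj]

theorem ofReal_specD (K : ℕ) (a : Fin 3) (f : (Fin 3 → ℤ) → ℝ) (j : Fin 3 → ℤ) :
    (specD K a f j : ℂ) =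
      fourierMultiplier K (fun k => 2 * (Real.pi : ℂ) * Complex.I * (k a : ℂ)) f j :=
  Complex.conj_eq_iff_re.mp (conj_fourierMultiplier K _ (fun k => by simp [Complex.conj_ofNat]) f j)

theorem ofReal_specD2 (K : ℕ) (a : Fin 3) (f : (Fin 3 → ℤ) → ℝ) (j : Fin 3 → ℤ) :
    (specD2 K a f j : ℂ) =
      fourierMultiplier K (fun k => -4 * (Real.pi : ℂ) ^ 2 * (k a : ℂ) ^ 2) f j :=
  Complex.conj_eq_iff_re.mp (conj_fourierMultiplier K _ (fun k => by simp [Complex.conj_ofNat]) f j)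

/-!
The estimate is a discrete Sobolev inequality, applied to each component `g = D_a f` of the
gradient, and the difficulty is uniformity in `N`. It is resolved by replacing spectral derivatives
by forward differences, for which the Gagliardo–Nirenberg argument works directly on the grid.

* On the Fourier side, the forward difference in the direction `b` has a symbol of modulus at most
  `2π |k_b| h`. Since the frequencies are integers, `|k_a|` and `|k_a k_b|` are at most `|k|²`, so
  Parseval's identity (`sum_norm_sq_trigPoly`) bounds both `‖g‖₂` and the `L²` norm of the forward
  difference quotients of `g` by `E = ‖Δ_N f‖₂` (`sum_specD_sq_le`, `sum_specD_diff_sq_le`).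
* On the physical side, a periodic grid function `u` is at most its average plus its variation
  along each line (`le_average_add_variation`). Multiplying the square roots of the three bounds
  and applying the Loomis–Whitney inequality (`sum_mul_mul_sq_le`) bounds `‖u‖_{3/2}` by the
  discrete `W^{1,1}` norm (`sum_cube_sq_le_prod_lineBoundSum`). For `u = g⁴` the Cauchy–Schwarz
  inequality gives `‖g‖₆⁴ ≤ ‖g‖₆³ · 5 E` (`sum_pow_six_le`), and `‖g‖₆` cancels.
-/

/-! ### Sums over the grid -/

theorem sum_gridBox {M : Type*} [AddCommMonoid M] (K : ℕ) (F : (Fin 3 → ℤ) → M) :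
    ∑ x ∈ gridBox K, F x = ∑ i ∈ Finset.range (gridN K), ∑ j ∈ Finset.range (gridN K),
      ∑ k ∈ Finset.range (gridN K), F ![(i : ℤ), (j : ℤ), (k : ℤ)] := by
  simp only [← Finset.sum_product']
  symm
  refine Finset.sum_nbij' (fun p => ![(p.1 : ℤ), (p.2.1 : ℤ), (p.2.2 : ℤ)])
    (fun x => ((x 0).toNat, (x 1).toNat, (x 2).toNat)) ?_ ?_ ?_ ?_ ?_
  · rintro ⟨i, j, k⟩ h
    simp only [Finset.mem_product, Finset.mem_range] at h
    simp only [gridBox, Fintype.mem_piFinset, Finset.mem_Ico, Fin.forall_fin_succ]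
    simp
    omega
  · intro x h
    simp only [gridBox, Fintype.mem_piFinset, Finset.mem_Ico] at h
    have := h 0
    have := h 1
    have := h 2
    simp only [Finset.mem_product, Finset.mem_range]
    omega
  · rintro ⟨i, j, k⟩ _
    simp
  · intro x h
    simp only [gridBox, Fintype.mem_piFinset, Finset.mem_Ico] at h
    have := h 0
    have := h 1
    have := h 2
    ext a
    fin_cases a <;> simp <;> omega
  · intros
    rfl

theorem vec_add_single_zero (i j k : ℤ) (c : ℤ) :
    (![i, j, k] : Fin 3 → ℤ) + Pi.single 0 c = ![i + c, j, k] := by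
  ext a; fin_cases a <;> simp

theorem vec_add_single_one (i j k : ℤ) (c : ℤ) :
    (![i, j, k] : Fin 3 → ℤ) + Pi.single 1 c = ![i, j + c, k] := by
  ext a; fin_cases a <;> simp

theorem vec_add_single_two (i j k : ℤ) (c : ℤ) :
    (![i, j, k] : Fin 3 → ℤ) + Pi.single 2 c = ![i, j, k + c] := by
  ext a; fin_cases a <;> simp

theorem sum_range_shift_of_eq {n : ℕ} {F : ℕ → ℝ} (hF : F n = F 0) :
    ∑ i ∈ Finset.range n, F (i + 1) = ∑ i ∈ Finset.range n, F i := by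
  have := Finset.sum_range_sub F n
  rw [Finset.sum_sub_distrib] at this
  linarith

theorem sum_gridBox_shift {K : ℕ} {F : (Fin 3 → ℤ) → ℝ} (hF : F ∈ gridFunctions K) (b : Fin 3) :
    ∑ x ∈ gridBox K, F (x + Pi.single b 1) = ∑ x ∈ gridBox K, F x := by
  replace hF : ∀ (j : Fin 3 → ℤ) (a : Fin 3), F (j + Pi.single a (gridN K : ℤ)) = F j := hF
  rw [sum_gridBox, sum_gridBox]
  fin_cases b
  · simp only [Fin.zero_eta, vec_add_single_zero]
    have := sum_range_shift_of_eq (n := gridN K) (F := fun i : ℕ =>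
      ∑ j ∈ Finset.range (gridN K), ∑ k ∈ Finset.range (gridN K), F ![(i : ℤ), (j : ℤ), (k : ℤ)])
      (Finset.sum_congr rfl fun j _ => Finset.sum_congr rfl fun k _ => by
        rw [← hF ![((0 : ℕ) : ℤ), j, k] 0, vec_add_single_zero]; simp)
    simpa using this
  · simp only [Fin.mk_one, vec_add_single_one]
    refine Finset.sum_congr rfl fun i _ => ?_
    have := sum_range_shift_of_eq (n := gridN K) (F := fun j : ℕ =>
      ∑ k ∈ Finset.range (gridN K), F ![(i : ℤ), (j : ℤ), (k : ℤ)])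
      (Finset.sum_congr rfl fun k _ => by
        rw [← hF ![(i : ℤ), ((0 : ℕ) : ℤ), k] 1, vec_add_single_one]; simp)
    simpa using this
  · simp only [Fin.reduceFinMk, vec_add_single_two]
    refine Finset.sum_congr rfl fun i _ => Finset.sum_congr rfl fun j _ => ?_
    have := sum_range_shift_of_eq (n := gridN K) (F := fun k : ℕ => F ![(i : ℤ), (j : ℤ), (k : ℤ)])
      (by rw [← hF ![(i : ℤ), j, ((0 : ℕ) : ℤ)] 2, vec_add_single_two]; simp)
    simpa using this

/-! ### The discrete Gagliardo–Nirenberg–Sobolev inequality -/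

/-- The Loomis–Whitney inequality for finite sums in three dimensions. -/
theorem sum_mul_mul_sq_le {ι : Type*} (s : Finset ι) (A B C : ι → ι → ℝ) :
    (∑ i ∈ s, ∑ j ∈ s, ∑ k ∈ s, A j k * B i k * C i j) ^ 2 ≤
      (∑ j ∈ s, ∑ k ∈ s, A j k ^ 2) * (∑ i ∈ s, ∑ k ∈ s, B i k ^ 2) *
        (∑ i ∈ s, ∑ j ∈ s, C i j ^ 2) := by
  have h1 : ∑ i ∈ s, ∑ j ∈ s, ∑ k ∈ s, A j k * B i k * C i j =
      ∑ p ∈ s ×ˢ s, A p.1 p.2 * ∑ i ∈ s, B i p.2 * C i p.1 := by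
    rw [Finset.sum_product, Finset.sum_comm]
    refine Finset.sum_congr rfl fun j _ => ?_
    rw [Finset.sum_comm]
    refine Finset.sum_congr rfl fun k _ => ?_
    rw [Finset.mul_sum]
    exact Finset.sum_congr rfl fun i _ => by ring
  rw [h1, mul_assoc]
  refine (Finset.sum_mul_sq_le_sq_mul_sq _ _ _).trans ?_
  rw [Finset.sum_product]
  refine mul_le_mul_of_nonneg_left ?_ (by positivity)
  calc ∑ p ∈ s ×ˢ s, (∑ i ∈ s, B i p.2 * C i p.1) ^ 2
      ≤ ∑ p ∈ s ×ˢ s, (∑ i ∈ s, B i p.2 ^ 2) * ∑ i ∈ s, C i p.1 ^ 2 :=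
        Finset.sum_le_sum fun p _ => Finset.sum_mul_sq_le_sq_mul_sq _ _ _
    _ = (∑ i ∈ s, ∑ k ∈ s, B i k ^ 2) * ∑ i ∈ s, ∑ j ∈ s, C i j ^ 2 := by
        rw [Finset.sum_product, Finset.sum_comm, Finset.sum_comm (f := fun i k => B i k ^ 2),
          Finset.sum_comm (f := fun i j => C i j ^ 2), Finset.sum_mul_sum]

/-- A value is at most the average plus the total variation. -/
theorem le_average_add_variation {n : ℕ} (u : ℕ → ℝ) {i : ℕ} (hi : i < n) :
    u i ≤ 1 / (n : ℝ) * ∑ l ∈ Finset.range n, u l + ∑ l ∈ Finset.range n, |u (l + 1) - u l| := by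
  set V := ∑ l ∈ Finset.range n, |u (l + 1) - u l|
  have key : ∀ a b : ℕ, a ≤ b → b < n → |u a - u b| ≤ V := by
    intro a b hab hb
    calc |u a - u b| ≤ ∑ l ∈ Finset.Ico a b, |u l - u (l + 1)| := by
          simpa [Real.dist_eq] using dist_le_Ico_sum_dist u hab
      _ ≤ ∑ l ∈ Finset.range n, |u l - u (l + 1)| :=
          Finset.sum_le_sum_of_subset_of_nonneg
            (fun l hl => by simp at hl ⊢; omega) fun _ _ _ => abs_nonneg _
      _ = V := Finset.sum_congr rfl fun l _ => abs_sub_comm _ _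
  have h1 : ∀ m ∈ Finset.range n, u i ≤ u m + V := by
    intro m hm
    rcases le_total i m with h | h
    · linarith [le_abs_self (u i - u m), key i m h (Finset.mem_range.mp hm)]
    · linarith [neg_abs_le (u m - u i), key m i h hi]
  have h2 := Finset.sum_le_sum h1
  simp only [Finset.sum_const, Finset.card_range, nsmul_eq_mul, Finset.sum_add_distrib] at h2
  have hn : (0 : ℝ) < n := by exact_mod_cast (Nat.zero_le i).trans_lt hi
  rw [← mul_le_mul_iff_right₀ hn]
  calc (n : ℝ) * u i ≤ _ := h2
    _ = _ := by field_simp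

/-- The sum of the bounds in `le_average_add_variation` over the `N²` grid lines of direction `b`.
For `u ≥ 0` it is `N²` times the discrete `W^{1,1}` norm in the direction `b`, that is, times the
mean over the grid of `|u| + |∂_b u|` with the forward difference quotient `∂_b`. -/
noncomputable def lineBoundSum (K : ℕ) (u : (Fin 3 → ℤ) → ℝ) (b : Fin 3) : ℝ :=
  1 / (gridN K : ℝ) * ∑ x ∈ gridBox K, u x + ∑ x ∈ gridBox K, |u (x + Pi.single b 1) - u x|

/-- The discrete embedding of `W^{1,1}` into `L^{3/2}`, for `u = v²`. -/
theorem sum_cube_sq_le_prod_lineBoundSum (K : ℕ) (v : (Fin 3 → ℤ) → ℝ) (hv : ∀ x, 0 ≤ v x) :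
    (∑ x ∈ gridBox K, v x ^ 3) ^ 2 ≤ ∏ b, lineBoundSum K (fun x => v x ^ 2) b := by
  set s := Finset.range (gridN K) with hs
  set w : ℕ → ℕ → ℕ → ℝ := fun i j k => v ![(i : ℤ), (j : ℤ), (k : ℤ)] with hw
  let A : ℕ → ℕ → ℝ := fun j k =>
    1 / (gridN K : ℝ) * ∑ l ∈ s, w l j k ^ 2 + ∑ l ∈ s, |w (l + 1) j k ^ 2 - w l j k ^ 2|
  let B : ℕ → ℕ → ℝ := fun i k =>
    1 / (gridN K : ℝ) * ∑ l ∈ s, w i l k ^ 2 + ∑ l ∈ s, |w i (l + 1) k ^ 2 - w i l k ^ 2|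
  let C : ℕ → ℕ → ℝ := fun i j =>
    1 / (gridN K : ℝ) * ∑ l ∈ s, w i j l ^ 2 + ∑ l ∈ s, |w i j (l + 1) ^ 2 - w i j l ^ 2|
  have hA : ∀ j k, 0 ≤ A j k := fun j k => by positivity
  have hB : ∀ j k, 0 ≤ B j k := fun j k => by positivity
  have hC : ∀ j k, 0 ≤ C j k := fun j k => by positivity
  have h0 : lineBoundSum K (fun x => v x ^ 2) 0 = ∑ j ∈ s, ∑ k ∈ s, A j k := by
    simp only [lineBoundSum, sum_gridBox, vec_add_single_zero, A, Finset.sum_add_distrib,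
      ← Finset.mul_sum, hw, Nat.cast_add, Nat.cast_one, ← hs]
    congr 1
    · congr 1
      rw [Finset.sum_comm]
      exact Finset.sum_congr rfl fun j _ => Finset.sum_comm
    · rw [Finset.sum_comm]
      exact Finset.sum_congr rfl fun j _ => Finset.sum_comm
  have h1 : lineBoundSum K (fun x => v x ^ 2) 1 = ∑ i ∈ s, ∑ k ∈ s, B i k := by
    simp only [lineBoundSum, sum_gridBox, vec_add_single_one, B, Finset.sum_add_distrib,
      ← Finset.mul_sum, hw, Nat.cast_add, Nat.cast_one, ← hs]
    congr 1
    · congr 1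
      exact Finset.sum_congr rfl fun j _ => Finset.sum_comm
    · exact Finset.sum_congr rfl fun j _ => Finset.sum_comm
  have h2 : lineBoundSum K (fun x => v x ^ 2) 2 = ∑ i ∈ s, ∑ j ∈ s, C i j := by
    simp only [lineBoundSum, sum_gridBox, vec_add_single_two, C, Finset.sum_add_distrib,
      ← Finset.mul_sum, hw, Nat.cast_add, Nat.cast_one, ← hs]
  have hLW := sum_mul_mul_sq_le s (fun j k => √(A j k)) (fun i k => √(B i k))
    (fun i j => √(C i j))
  simp only [Real.sq_sqrt (hA _ _), Real.sq_sqrt (hB _ _), Real.sq_sqrt (hC _ _)] at hLW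
  rw [Fin.prod_univ_three, h0, h1, h2, sum_gridBox]
  refine le_trans (pow_le_pow_left₀ ?_ ?_ 2) hLW
  · exact Finset.sum_nonneg fun i _ => Finset.sum_nonneg fun j _ => Finset.sum_nonneg fun k _ =>
      pow_nonneg (hv _) 3
  · refine Finset.sum_le_sum fun i hi => Finset.sum_le_sum fun j hj =>
      Finset.sum_le_sum fun k hk => ?_
    rw [Finset.mem_range] at hi hj hk
    have hx : 0 ≤ w i j k := hv _
    have ha : w i j k ≤ √(A j k) :=
      Real.le_sqrt_of_sq_le (le_average_add_variation (fun l => w l j k ^ 2) hi)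
    have hb : w i j k ≤ √(B i k) :=
      Real.le_sqrt_of_sq_le (le_average_add_variation (fun l => w i l k ^ 2) hj)
    have hc : w i j k ≤ √(C i j) :=
      Real.le_sqrt_of_sq_le (le_average_add_variation (fun l => w i j l ^ 2) hk)
    calc w i j k ^ 3 = w i j k * w i j k * w i j k := by ring
      _ ≤ √(A j k) * √(B i k) * √(C i j) := by gcongr

theorem abs_pow_four_sub_le (a b : ℝ) : |a ^ 4 - b ^ 4| ≤ |a - b| * (2 * (|a| ^ 3 + |b| ^ 3)) := by
  have h : a ^ 4 - b ^ 4 = (a - b) * ((a + b) * (a ^ 2 + b ^ 2)) := by ring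
  rw [h, abs_mul]
  refine mul_le_mul_of_nonneg_left ?_ (abs_nonneg _)
  rw [abs_mul, abs_of_nonneg (by positivity : 0 ≤ a ^ 2 + b ^ 2), ← sq_abs a, ← sq_abs b]
  have h1 := abs_add_le a b
  have ha := abs_nonneg a
  have hb := abs_nonneg b
  calc |a + b| * (|a| ^ 2 + |b| ^ 2) ≤ (|a| + |b|) * (|a| ^ 2 + |b| ^ 2) := by gcongr
    _ ≤ 2 * (|a| ^ 3 + |b| ^ 3) := by
      nlinarith [mul_nonneg (add_nonneg ha hb) (sq_nonneg (|a| - |b|))]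

theorem gridN_pos (K : ℕ) : (0 : ℝ) < gridN K := by
  exact_mod_cast Nat.succ_pos (2 * K)

/-- The bound of the discrete `W^{1,1}` norm of `g⁴` by the Cauchy–Schwarz inequality, in the form
`‖g³ ∂g‖₁ ≤ ‖∂g‖₂ ‖g³‖₂`. -/
theorem lineBoundSum_pow_four_le {K : ℕ} {g : (Fin 3 → ℤ) → ℝ} (hg : g ∈ gridFunctions K)
    {E : ℝ} (hE : 0 ≤ E) (b : Fin 3)
    (h2 : ∑ x ∈ gridBox K, g x ^ 2 ≤ gridN K ^ 3 * E ^ 2)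
    (hd : ∑ x ∈ gridBox K, (g (x + Pi.single b 1) - g x) ^ 2 ≤ gridN K * E ^ 2) :
    lineBoundSum K (fun x => g x ^ 4) b ≤
      5 * E * √(gridN K) * √(∑ x ∈ gridBox K, g x ^ 6) := by
  have hN := gridN_pos K
  set N : ℝ := (gridN K : ℝ)
  set P := ∑ x ∈ gridBox K, g x ^ 6
  have hcube : ∀ t : ℝ, (|t| ^ 3) ^ 2 = t ^ 6 := fun t => by
    rw [← pow_mul]; exact (show Even 6 by decide).pow_abs _
  have hsN : √N ^ 2 = N := Real.sq_sqrt hN.le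
  have hshift : ∑ x ∈ gridBox K, g (x + Pi.single b 1) ^ 6 = P :=
    sum_gridBox_shift (F := fun x => g x ^ 6)
      (fun j a => congrArg (· ^ 6) (hg j a)) b
  have e1 : ∑ x ∈ gridBox K, g x ^ 4 ≤ N * √N * E * √P := by
    calc ∑ x ∈ gridBox K, g x ^ 4 = ∑ x ∈ gridBox K, |g x| * |g x| ^ 3 :=
          Finset.sum_congr rfl fun x _ => by
            rw [← pow_succ', (show Even 4 by decide).pow_abs]
      _ ≤ √(∑ x ∈ gridBox K, |g x| ^ 2) * √(∑ x ∈ gridBox K, (|g x| ^ 3) ^ 2) :=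
          Real.sum_mul_le_sqrt_mul_sqrt _ _ _
      _ ≤ (N * √N * E) * √P := by
          simp only [hcube, sq_abs]
          gcongr
          refine Real.sqrt_le_iff.mpr ⟨by positivity, h2.trans_eq ?_⟩
          rw [mul_pow, mul_pow, hsN]; ring
  have e2 : ∀ c : (Fin 3 → ℤ) → ℝ, ∑ x ∈ gridBox K, c x ^ 6 = P →
      ∑ x ∈ gridBox K, |g (x + Pi.single b 1) - g x| * |c x| ^ 3 ≤ √N * E * √P := by
    intro c hc
    refine (Real.sum_mul_le_sqrt_mul_sqrt _ _ _).trans ?_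
    simp only [hcube, sq_abs, hc]
    gcongr
    refine Real.sqrt_le_iff.mpr ⟨by positivity, hd.trans_eq ?_⟩
    rw [mul_pow, hsN]
  have e3 : ∑ x ∈ gridBox K, |g (x + Pi.single b 1) ^ 4 - g x ^ 4| ≤ 4 * (√N * E * √P) := by
    calc _ ≤ ∑ x ∈ gridBox K, |g (x + Pi.single b 1) - g x| *
            (2 * (|g (x + Pi.single b 1)| ^ 3 + |g x| ^ 3)) :=
          Finset.sum_le_sum fun x _ => abs_pow_four_sub_le _ _
      _ = 2 * (∑ x ∈ gridBox K, |g (x + Pi.single b 1) - g x| * |g (x + Pi.single b 1)| ^ 3 +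
            ∑ x ∈ gridBox K, |g (x + Pi.single b 1) - g x| * |g x| ^ 3) := by
          rw [← Finset.sum_add_distrib, Finset.mul_sum]
          exact Finset.sum_congr rfl fun x _ => by ring
      _ ≤ _ := by linarith [e2 _ hshift, e2 g rfl]
  have e4 : 1 / N * ∑ x ∈ gridBox K, g x ^ 4 ≤ √N * E * √P := by
    calc _ ≤ 1 / N * (N * √N * E * √P) := by gcongr
      _ = _ := by field_simp
  unfold lineBoundSum
  linarith

/-- The discrete Sobolev inequality `‖g‖₆ ≤ 5 max (‖g‖₂, ‖∇g‖₂)`, with forward differences in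
place of the gradient and without the normalisation of the norms by powers of `N = 1 / h`. -/
theorem sum_pow_six_le {K : ℕ} {g : (Fin 3 → ℤ) → ℝ} (hg : g ∈ gridFunctions K)
    {E : ℝ} (hE : 0 ≤ E)
    (h2 : ∑ x ∈ gridBox K, g x ^ 2 ≤ gridN K ^ 3 * E ^ 2)
    (hd : ∀ b, ∑ x ∈ gridBox K, (g (x + Pi.single b 1) - g x) ^ 2 ≤ gridN K * E ^ 2) :
    ∑ x ∈ gridBox K, g x ^ 6 ≤ gridN K ^ 3 * (5 * E) ^ 6 := by
  have hN := gridN_pos K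
  have h := sum_cube_sq_le_prod_lineBoundSum K (fun x => g x ^ 2) fun x => sq_nonneg _
  simp only [← pow_mul, Nat.reduceMul] at h
  set P := ∑ x ∈ gridBox K, g x ^ 6
  have hP : 0 ≤ P := Finset.sum_nonneg fun x _ => (show Even 6 by decide).pow_nonneg _
  have hb : P ^ 2 ≤ (5 * E * √(gridN K) * √P) ^ 3 := by
    refine h.trans ?_
    rw [Fin.prod_univ_three, pow_three']
    have h0 : ∀ b, 0 ≤ lineBoundSum K (fun x => g x ^ 4) b := fun b =>
      add_nonneg (mul_nonneg (by positivity) (Finset.sum_nonneg fun x _ => by positivity))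
        (Finset.sum_nonneg fun x _ => abs_nonneg _)
    have hle := fun b => lineBoundSum_pow_four_le hg hE b h2 (hd b)
    gcongr
    all_goals first | apply h0 | apply hle
  rcases hP.eq_or_lt with h0 | h0
  · rw [← h0]; positivity
  -- Cancelling `P ^ (3 / 2)` leaves `√P ≤ (5 E √N) ^ 3`.
  have hs : 0 < √P := Real.sqrt_pos.mpr h0
  have hsP : √P ^ 2 = P := Real.sq_sqrt hP
  have hsN : √(gridN K : ℝ) ^ 2 = gridN K := Real.sq_sqrt hN.le
  have h3 : √P ≤ (5 * E * √(gridN K)) ^ 3 := by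
    refine le_of_mul_le_mul_right ?_ (pow_pos hs 3)
    calc √P * √P ^ 3 = (√P ^ 2) ^ 2 := by ring
      _ ≤ _ := by rw [hsP, ← mul_pow]; exact hb
  calc P = √P ^ 2 := hsP.symm
    _ ≤ ((5 * E * √(gridN K)) ^ 3) ^ 2 := by gcongr
    _ = (√(gridN K : ℝ) ^ 2) ^ 3 * (5 * E) ^ 6 := by ring
    _ = _ := by rw [hsN]

/-! ### Parseval's identity on the grid -/

theorem gridN_mul_meshSize (K : ℕ) : (gridN K : ℝ) * meshSize K = 1 := by
  unfold meshSize
  exact mul_one_div_cancel (gridN_pos K).ne'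

theorem sum_range_exp_eq_zero {K : ℕ} {m : ℤ} (hm : m ≠ 0) (hlt : |m| < gridN K) :
    ∑ i ∈ Finset.range (gridN K),
      Complex.exp (2 * (Real.pi : ℂ) * Complex.I * (m * (i * meshSize K) : ℝ)) = 0 := by
  set z := Complex.exp (2 * (Real.pi : ℂ) * Complex.I * (m * meshSize K : ℝ)) with hz
  have hNh : (gridN K : ℂ) * (meshSize K : ℂ) = 1 := by exact_mod_cast gridN_mul_meshSize K
  have hpow : ∀ i : ℕ,
      Complex.exp (2 * (Real.pi : ℂ) * Complex.I * (m * (i * meshSize K) : ℝ)) = z ^ i := by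
    intro i
    rw [hz, ← Complex.exp_nat_mul]
    congr 1
    push_cast
    ring
  simp only [hpow]
  have hzN : z ^ gridN K = 1 := by
    rw [← hpow, Complex.exp_eq_one_iff]
    refine ⟨m, ?_⟩
    push_cast
    rw [hNh]
    ring
  have hz1 : z ≠ 1 := by
    intro h
    obtain ⟨n, hn⟩ := Complex.exp_eq_one_iff.mp h
    have h1 : ((m * meshSize K : ℝ) : ℂ) = (n : ℂ) :=
      mul_left_cancel₀ Complex.two_pi_I_ne_zero (hn.trans (mul_comm _ _))
    have h2 : (m : ℝ) * meshSize K = n := by exact_mod_cast h1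
    have h3 : (m : ℝ) = n * gridN K := by
      rw [← h2, mul_assoc, mul_comm (meshSize K), gridN_mul_meshSize, mul_one]
    have h4 : m = n * gridN K := by exact_mod_cast h3
    exact hm (Int.eq_zero_of_abs_lt_dvd ⟨n, h4.trans (mul_comm _ _)⟩ hlt)
  have := geom_sum_mul z (gridN K)
  rw [hzN, sub_self] at this
  exact (mul_eq_zero.mp this).resolve_right (sub_ne_zero.mpr hz1)

theorem sum_gridBox_exp_eq_zero {K : ℕ} {k : Fin 3 → ℤ} (hk : k ≠ 0)
    (hlt : ∀ a, |k a| < gridN K) :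
    ∑ x ∈ gridBox K, Complex.exp (2 * (Real.pi : ℂ) * Complex.I * (gridPhase K k x : ℂ)) = 0 := by
  obtain ⟨a, ha⟩ := Function.ne_iff.mp hk
  simp only [gridPhase, Complex.ofReal_sum, Finset.mul_sum, Complex.exp_sum]
  unfold gridBox
  rw [← Finset.prod_univ_sum (fun _ => Finset.Ico (0 : ℤ) (gridN K : ℤ)) fun a (i : ℤ) =>
    Complex.exp (2 * (Real.pi : ℂ) * Complex.I * ((k a * (i * meshSize K) : ℝ) : ℂ))]
  refine Finset.prod_eq_zero (Finset.mem_univ a) ?_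
  rw [← sum_range_exp_eq_zero ha (hlt a)]
  refine Finset.sum_nbij' Int.toNat (fun i => (i : ℤ)) ?_ ?_ ?_ ?_ ?_
  · intro i; simp; omega
  · intro i; simp
  · intro i; simp; omega
  · intro i; simp
  · intro i hi
    have : ((i.toNat : ℤ) : ℝ) = i := by rw [Int.toNat_of_nonneg (Finset.mem_Ico.mp hi).1]
    rw [← this, Int.cast_natCast]

theorem gridPhase_add (K : ℕ) (k x y : Fin 3 → ℤ) :
    gridPhase K k (x + y) = gridPhase K k x + gridPhase K k y := by
  simp only [gridPhase, ← Finset.sum_add_distrib]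
  exact Finset.sum_congr rfl fun a _ => by simp; ring

theorem gridPhase_sub_left (K : ℕ) (k l x : Fin 3 → ℤ) :
    gridPhase K (k - l) x = gridPhase K k x - gridPhase K l x := by
  simp only [gridPhase, ← Finset.sum_sub_distrib]
  exact Finset.sum_congr rfl fun a _ => by simp; ring

theorem gridPhase_single (K : ℕ) (k : Fin 3 → ℤ) (b : Fin 3) (n : ℤ) :
    gridPhase K k (Pi.single b n) = k b * (n * meshSize K) := by
  unfold gridPhase
  rw [Finset.sum_eq_single b]
  · simp
  · intro a _ hab
    simp [Pi.single_eq_of_ne hab]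
  · simp

theorem card_gridBox (K : ℕ) : (gridBox K).card = gridN K ^ 3 := by
  simp [gridBox]

/-- Parseval's identity for trigonometric polynomials with frequencies in the box: distinct
frequencies differ by less than `N` in each coordinate, so no aliasing occurs. -/
theorem sum_norm_sq_trigPoly (K : ℕ) (c : (Fin 3 → ℤ) → ℂ) :
    ∑ x ∈ gridBox K, ‖∑ k ∈ freqBox K, c k *
        Complex.exp (2 * (Real.pi : ℂ) * Complex.I * (gridPhase K k x : ℂ))‖ ^ 2 =
      gridN K ^ 3 * ∑ k ∈ freqBox K, ‖c k‖ ^ 2 := by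
  apply Complex.ofReal_injective
  push_cast
  simp only [← Complex.mul_conj', map_sum, map_mul, ← Complex.exp_conj, Complex.conj_ofReal,
    Complex.conj_I, Complex.conj_ofNat, Finset.sum_mul_sum]
  rw [Finset.sum_comm, Finset.mul_sum]
  refine Finset.sum_congr rfl fun k hk => ?_
  rw [Finset.sum_comm]
  have hterm : ∀ l x, c k * Complex.exp (2 * (Real.pi : ℂ) * Complex.I * (gridPhase K k x : ℂ)) *
      ((starRingEnd ℂ) (c l) *
        Complex.exp (2 * (Real.pi : ℂ) * -Complex.I * (gridPhase K l x : ℂ))) =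
      c k * (starRingEnd ℂ) (c l) *
        Complex.exp (2 * (Real.pi : ℂ) * Complex.I * (gridPhase K (k - l) x : ℂ)) := by
    intro l x
    rw [gridPhase_sub_left, mul_mul_mul_comm, ← Complex.exp_add]
    congr 2
    push_cast
    ring
  simp only [hterm, ← Finset.mul_sum]
  rw [Finset.sum_eq_single_of_mem k hk]
  · simp [gridPhase, card_gridBox]
    ring
  · intro l hl hlk
    rw [sum_gridBox_exp_eq_zero (sub_ne_zero.mpr hlk.symm), mul_zero]
    intro a
    simp only [freqBox, Fintype.mem_piFinset, Finset.mem_Icc] at hk hl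
    have := hk a
    have := hl a
    simp only [Pi.sub_apply, gridN, abs_lt]
    push_cast
    omega

/-! ### Bounds by the discrete Laplacian -/

theorem ofReal_specLaplacian (K : ℕ) (f : (Fin 3 → ℤ) → ℝ) (x : Fin 3 → ℤ) :
    (specLaplacian K f x : ℂ) =
      fourierMultiplier K (fun k => -4 * (Real.pi : ℂ) ^ 2 * ∑ a, (k a : ℂ) ^ 2) f x := by
  simp only [specLaplacian, Complex.ofReal_sum, ofReal_specD2, fourierMultiplier,
    Finset.mul_sum, Finset.sum_mul]
  exact Finset.sum_comm

theorem specD_mem_gridFunctions (K : ℕ) (a : Fin 3) (f : (Fin 3 → ℤ) → ℝ) :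
    specD K a f ∈ gridFunctions K := by
  intro x b
  unfold specD fourierMultiplier
  congr 1
  refine Finset.sum_congr rfl fun k _ => ?_
  congr 1
  rw [gridPhase_add, gridPhase_single, Int.cast_natCast, gridN_mul_meshSize, mul_one,
    Complex.ofReal_add, mul_add, Complex.exp_add]
  conv_rhs => rw [← mul_one (Complex.exp _)]
  congr 1
  exact Complex.exp_eq_one_iff.mpr ⟨k b, by push_cast; ring⟩

theorem abs_mul_le_sum_sq (k : Fin 3 → ℤ) (a b : Fin 3) :
    |(k a : ℝ)| * |(k b : ℝ)| ≤ ∑ c, (k c : ℝ) ^ 2 := by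
  have h : ∀ c, |(k c : ℝ)| ^ 2 ≤ ∑ c, (k c : ℝ) ^ 2 := fun c => by
    rw [sq_abs]
    exact Finset.single_le_sum (f := fun c => (k c : ℝ) ^ 2) (fun c _ => sq_nonneg _)
      (Finset.mem_univ c)
  nlinarith [h a, h b, sq_nonneg (|(k a : ℝ)| - |(k b : ℝ)|)]

/-- Since the frequencies are integers, `|k_a| ≤ k_a²`: this is the Poincaré inequality on the
Fourier side. -/
theorem abs_le_sum_sq (k : Fin 3 → ℤ) (a : Fin 3) : |(k a : ℝ)| ≤ ∑ c, (k c : ℝ) ^ 2 := by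
  refine le_trans ?_ (abs_mul_le_sum_sq k a a)
  rcases eq_or_ne (k a) 0 with h | h
  · simp [h]
  · have : (1 : ℝ) ≤ |(k a : ℝ)| := by exact_mod_cast Int.one_le_abs h
    nlinarith

theorem norm_laplacian_symbol (k : Fin 3 → ℤ) :
    ‖-4 * (Real.pi : ℂ) ^ 2 * ∑ a, (k a : ℂ) ^ 2‖ = 4 * Real.pi ^ 2 * ∑ a, (k a : ℝ) ^ 2 := by
  have : -4 * (Real.pi : ℂ) ^ 2 * ∑ a, (k a : ℂ) ^ 2 =
      ((-(4 * Real.pi ^ 2 * ∑ a, (k a : ℝ) ^ 2) : ℝ) : ℂ) := by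
    push_cast; ring
  rw [this, Complex.norm_real, norm_neg, Real.norm_of_nonneg (by positivity)]

/-- Parseval's identity turns a pointwise bound of coefficients by those of the Laplacian into a
bound of sums of squares over the grid. -/
theorem sum_sq_le_of_coeff_le {K : ℕ} {f u : (Fin 3 → ℤ) → ℝ} {c : (Fin 3 → ℤ) → ℂ} {r : ℝ}
    (hu : ∀ x, (u x : ℂ) = ∑ k ∈ freqBox K, c k *
      Complex.exp (2 * (Real.pi : ℂ) * Complex.I * (gridPhase K k x : ℂ)))
    (hc : ∀ k, ‖c k‖ ≤ r * (4 * Real.pi ^ 2 * ∑ a, (k a : ℝ) ^ 2) * ‖dftCoeff K f k‖) :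
    ∑ x ∈ gridBox K, u x ^ 2 ≤ r ^ 2 * ∑ x ∈ gridBox K, specLaplacian K f x ^ 2 := by
  have hnorm : ∀ (w : (Fin 3 → ℤ) → ℝ) (x), w x ^ 2 = ‖(w x : ℂ)‖ ^ 2 := fun w x => by
    rw [Complex.norm_real, Real.norm_eq_abs, sq_abs]
  simp only [hnorm, hu, ofReal_specLaplacian, fourierMultiplier]
  rw [sum_norm_sq_trigPoly, sum_norm_sq_trigPoly, mul_left_comm, Finset.mul_sum (a := r ^ 2)]
  gcongr with k _
  rw [norm_mul, norm_laplacian_symbol, ← mul_pow, ← mul_assoc]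
  exact pow_le_pow_left₀ (norm_nonneg _) (hc k) 2

theorem sum_specD_sq_le (K : ℕ) (a : Fin 3) (f : (Fin 3 → ℤ) → ℝ) :
    ∑ x ∈ gridBox K, specD K a f x ^ 2 ≤ ∑ x ∈ gridBox K, specLaplacian K f x ^ 2 := by
  rw [← one_mul (∑ x ∈ gridBox K, specLaplacian K f x ^ 2), ← one_pow 2]
  refine sum_sq_le_of_coeff_le (fun x => ofReal_specD K a f x) fun k => ?_
  rw [norm_mul, one_mul]
  gcongr
  have hpi := Real.pi_gt_three
  have : ‖2 * (Real.pi : ℂ) * Complex.I * (k a : ℂ)‖ = 2 * Real.pi * |(k a : ℝ)| := by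
    simp [abs_of_pos Real.pi_pos]
  rw [this]
  have hk := abs_le_sum_sq k a
  calc 2 * Real.pi * |(k a : ℝ)| ≤ 4 * Real.pi ^ 2 * |(k a : ℝ)| :=
        mul_le_mul_of_nonneg_right (by nlinarith) (abs_nonneg _)
    _ ≤ _ := by gcongr

/-- The forward difference has the symbol `exp (2πi k_b h) - 1`, of modulus at most `2π |k_b| h`,
so it is dominated by `h` times the spectral derivative. -/
theorem sum_specD_diff_sq_le (K : ℕ) (a b : Fin 3) (f : (Fin 3 → ℤ) → ℝ) :
    ∑ x ∈ gridBox K, (specD K a f (x + Pi.single b 1) - specD K a f x) ^ 2 ≤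
      meshSize K ^ 2 * ∑ x ∈ gridBox K, specLaplacian K f x ^ 2 := by
  have hh : 0 ≤ meshSize K := by unfold meshSize; positivity
  refine sum_sq_le_of_coeff_le (u := fun x => specD K a f (x + Pi.single b 1) - specD K a f x)
    (c := fun k => 2 * (Real.pi : ℂ) * Complex.I * (k a : ℂ) * dftCoeff K f k *
      (Complex.exp (Complex.I * (2 * Real.pi * (k b * meshSize K) : ℝ)) - 1)) ?_ ?_
  · intro x
    rw [Complex.ofReal_sub, ofReal_specD, ofReal_specD]
    simp only [fourierMultiplier, ← Finset.sum_sub_distrib]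
    refine Finset.sum_congr rfl fun k _ => ?_
    have : Complex.exp (2 * (Real.pi : ℂ) * Complex.I * (gridPhase K k (x + Pi.single b 1) : ℂ)) =
        Complex.exp (2 * (Real.pi : ℂ) * Complex.I * (gridPhase K k x : ℂ)) *
          Complex.exp (Complex.I * (2 * Real.pi * (k b * meshSize K) : ℝ)) := by
      rw [gridPhase_add, gridPhase_single, ← Complex.exp_add]
      congr 1
      push_cast
      ring
    rw [this]
    ring
  · intro k
    have h1 : ‖2 * (Real.pi : ℂ) * Complex.I * (k a : ℂ)‖ = 2 * Real.pi * |(k a : ℝ)| := by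
      simp [abs_of_pos Real.pi_pos]
    have h2 : ‖Complex.exp (Complex.I * (2 * Real.pi * (k b * meshSize K) : ℝ)) - 1‖ ≤
        2 * Real.pi * (|(k b : ℝ)| * meshSize K) := by
      refine Real.norm_exp_I_mul_ofReal_sub_one_le.trans_eq ?_
      rw [Real.norm_eq_abs, abs_mul, abs_of_pos (by positivity : 0 < 2 * Real.pi),
        abs_mul, abs_of_nonneg hh]
    rw [norm_mul, norm_mul, h1]
    calc _ ≤ 2 * Real.pi * |(k a : ℝ)| * ‖dftCoeff K f k‖ *
          (2 * Real.pi * (|(k b : ℝ)| * meshSize K)) := by gcongr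
      _ = meshSize K * (4 * Real.pi ^ 2 * (|(k a : ℝ)| * |(k b : ℝ)|)) * ‖dftCoeff K f k‖ := by
          ring
      _ ≤ _ := by
          have := abs_mul_le_sum_sq k a b
          gcongr

/-! ### The discrete Sobolev estimate for the gradient -/

theorem sum_specD_pow_six_le (K : ℕ) (a : Fin 3) (f : (Fin 3 → ℤ) → ℝ) :
    meshSize K ^ 3 * ∑ x ∈ gridBox K, specD K a f x ^ 6 ≤
      (5 * gridNorm K 2 (specLaplacian K f)) ^ 6 := by
  have hN := gridN_pos K
  have hNh := gridN_mul_meshSize K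
  have hh : 0 ≤ meshSize K := by unfold meshSize; positivity
  have hNh3 : (gridN K : ℝ) ^ 3 * meshSize K ^ 3 = 1 := by rw [← mul_pow, hNh, one_pow]
  set E := gridNorm K 2 (specLaplacian K f) with hEdef
  have hE : 0 ≤ E := by unfold E gridNorm; positivity
  have hE2 : E ^ 2 = meshSize K ^ 3 * ∑ x ∈ gridBox K, specLaplacian K f x ^ 2 := by
    rw [hEdef, gridNorm, ← Real.sqrt_eq_rpow, Real.sq_sqrt (by positivity)]
    simp
  have hL : ∑ x ∈ gridBox K, specLaplacian K f x ^ 2 = gridN K ^ 3 * E ^ 2 := by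
    rw [hE2, ← mul_assoc, hNh3, one_mul]
  have h := sum_pow_six_le (specD_mem_gridFunctions K a f) hE
    ((sum_specD_sq_le K a f).trans_eq hL) fun b =>
      (sum_specD_diff_sq_le K a b f).trans_eq <| by
        rw [hL]
        linear_combination (gridN K * E ^ 2) * (gridN K * meshSize K + 1) * hNh
  calc _ ≤ meshSize K ^ 3 * (gridN K ^ 3 * (5 * E) ^ 6) := by gcongr
    _ = _ := by rw [← mul_assoc, mul_comm (meshSize K ^ 3), hNh3, one_mul]

theorem norm_specGrad_pow_six_le (K : ℕ) (f : (Fin 3 → ℤ) → ℝ) (x : Fin 3 → ℤ) :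
    ‖specGrad K f x‖ ^ 6 ≤ 9 * ∑ a, specD K a f x ^ 6 := by
  have h1 : ‖specGrad K f x‖ ^ 2 = ∑ a, specD K a f x ^ 2 := by
    rw [EuclideanSpace.norm_sq_eq]
    simp [specGrad]
  calc ‖specGrad K f x‖ ^ 6 = (∑ a, specD K a f x ^ 2) ^ 3 := by rw [← h1, ← pow_mul]
    _ ≤ 3 ^ 2 * ∑ a, (specD K a f x ^ 2) ^ 3 := by
        have := pow_sum_div_card_le_sum_pow (s := Finset.univ) (f := fun a => specD K a f x ^ 2)
          (fun a _ => sq_nonneg _) 2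
        rwa [div_le_iff₀' (by simp), Finset.card_univ, Fintype.card_fin] at this
    _ = _ := by simp only [← pow_mul]; norm_num

theorem mainTheorem4 :
    ∃ C : ℝ, 0 < C ∧ ∀ (K : ℕ) (f : (Fin 3 → ℤ) → ℝ), f ∈ gridFunctions K →
      gridNorm K 6 (specGrad K f) ≤ C * gridNorm K 2 (specLaplacian K f) := by
  refine ⟨10, by norm_num, fun K f _ => ?_⟩
  have hh : 0 ≤ meshSize K := by unfold meshSize; positivity
  set E := gridNorm K 2 (specLaplacian K f) with hEdef
  have hE : 0 ≤ E := by unfold E gridNorm; positivity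
  have key : meshSize K ^ 3 * ∑ x ∈ gridBox K, ‖specGrad K f x‖ ^ 6 ≤ (10 * E) ^ 6 := by
    calc _ ≤ meshSize K ^ 3 * ∑ x ∈ gridBox K, 9 * ∑ a, specD K a f x ^ 6 := by
          gcongr with x
          exact norm_specGrad_pow_six_le K f x
      _ = 9 * ∑ a, meshSize K ^ 3 * ∑ x ∈ gridBox K, specD K a f x ^ 6 := by
          rw [← Finset.mul_sum, ← Finset.mul_sum, Finset.sum_comm]
          ring
      _ ≤ 9 * ∑ _a : Fin 3, (5 * E) ^ 6 := by
          gcongr with a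
          exact sum_specD_pow_six_le K a f
      _ ≤ (10 * E) ^ 6 := by
          -- `27 ≤ 2 ^ 6` absorbs the number of components.
          simp only [Finset.sum_const, Finset.card_univ, Fintype.card_fin, nsmul_eq_mul, mul_pow]
          push_cast
          nlinarith [pow_nonneg hE 6]
  unfold gridNorm
  have hcast : ∀ y : ℝ, y ^ (6 : ℝ) = y ^ 6 := fun y => by
    rw [← Real.rpow_natCast]; norm_num
  simp only [hcast]
  calc _ ≤ ((10 * E) ^ 6) ^ (1 / 6 : ℝ) := Real.rpow_le_rpow (by positivity) key (by norm_num)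
    _ = 10 * E := by
        rw [← hcast, ← Real.rpow_mul (by positivity)]
        norm_num
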